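/- Let $(\Omega,\mathcal F,\mathbb P)$ be a complete probability space with a filtration $(\mathcal F_t)_{t\ge 0}$ satisfying the usual conditions (it is right continuous, and $\mathcal F_0$ contains all subsets of $\mathbb P$-null sets of $\mathcal F$), and let $L^0(\Omega,\mathcal F,\mathbb P)$ be the space of classes of real random variables modulo $\mathbb P$-a.e. equality, with the topology of convergence in probability. Let $H$ and $G$ be separable real Hilbert spaces and let $T>0$. Let $M=(M_t)_{t\in[0,T]}$ be a cylindrical square integrable martingale in $H$, i.e. each $M_t:H\to L^0(\Omega,\mathcal F,\mathbb P)$ is linear and, for every $h\in H$, $(M_t(h))_{t\in[0,T]}$ is a real-valued square integrable martingale with respect to $(\mathcal F_t)_{t\in[0,T]}$. Assume that for each $t\in[0,T]$ the map $M_t:H\to L^0(\Omega,\mathcal F,\mathbb P)$ is continuous. Let $S:H\to G$ be a Hilbert--Schmidt operator, i.e. a continuous linear operator with $\sum_n\|Sh_n\|^2<\infty$ for some (equivalently, any) complete orthonormal system $(h_n)$ of $H$, and let $S^*:G\to H$ be its adjoint. Then $M\circ S^*=(M_t\circ S^*)_{t\in[0,T]}$ is a cylindrical square integrable martingale in $G$,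 and it has a $G$-valued càdlàg version that is a square integrable martingale: there is a $G$-valued process $X=(X_t)_{t\in[0,T]}$ with càdlàg paths which is a martingale with respect to $(\mathcal F_t)_{t\in[0,T]}$, satisfies $\mathbb E\|X_t\|^2<\infty$ for all $t\in[0,T]$, and is such that for every $t\in[0,T]$ and $g\in G$, $\langle X_t,g\rangle=M_t(S^*g)$ $\mathbb P$-a.e. -/

import Mathlib

open MeasureTheory Filter Topology
open scoped NNReal ENNReal

universe u

/-- The usual conditions: the filtration is right continuous and `𝓕 0` contains every subset of
an event of probability zero (`P s = 0` for an arbitrary set `s` says that `s` is contained in a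
measurable null set). -/
structure UsualConditions {Ω : Type*} {m : MeasurableSpace Ω} (𝓕 : Filtration ℝ≥0 m)
    (P : Measure Ω) : Prop where
  rightContinuous : 𝓕.IsRightContinuous
  null_measurable : ∀ s : Set Ω, P s = 0 → MeasurableSet[𝓕 0] s

/-- The restriction to the time interval `[0,T]` of a filtration indexed by `[0,∞)`. -/
def MeasureTheory.Filtration.restrictIcc {Ω : Type*} {m : MeasurableSpace Ω}
    (𝓕 : Filtration ℝ≥0 m) (T : ℝ≥0) : Filtration (Set.Icc (0 : ℝ≥0) T) m where
  seq t := 𝓕 t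
  mono' _ _ h := 𝓕.mono h
  le' t := 𝓕.le t

/-- A bounded operator is Hilbert-Schmidt if `∑ ‖S hᵢ‖² < ∞` for some complete orthonormal system
`(hᵢ)` of `H`. -/
def IsHilbertSchmidt {H : Type u} {G : Type*} [NormedAddCommGroup H] [InnerProductSpace ℝ H]
    [NormedAddCommGroup G] [InnerProductSpace ℝ G] (S : H →L[ℝ] G) : Prop :=
  ∃ (ι : Type u) (b : HilbertBasis ι ℝ H), Summable fun i => ‖S (b i)‖ ^ 2

/-- A square integrable martingale with values in a Banach space. -/
def IsSquareIntegrableMartingale {Ω J E : Type*} [Preorder J] {m : MeasurableSpace Ω}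
    [NormedAddCommGroup E] [NormedSpace ℝ E] [CompleteSpace E]
    (X : J → Ω → E) (𝓕 : Filtration J m) (P : Measure Ω) : Prop :=
  Martingale X 𝓕 P ∧ ∀ t, MemLp (X t) 2 P

/-- A path is càdlàg if it is right continuous and has left limits
(at a point without points to its left the second condition is void). -/
def IsCadlagPath {J E : Type*} [Preorder J] [TopologicalSpace J] [TopologicalSpace E]
    (f : J → E) : Prop :=
  ∀ t, ContinuousWithinAt f (Set.Ici t) t ∧ ∃ l, Tendsto f (𝓝[<] t) (𝓝 l)

/-- A cylindrical random variable in `H`: a linear map from `H` into the space `L⁰(Ω, P)` of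
classes of real random variables modulo almost sure equality. -/
abbrev CylindricalRV {Ω : Type*} [MeasurableSpace Ω] (H : Type*) [NormedAddCommGroup H]
    [InnerProductSpace ℝ H] (P : Measure Ω) : Type _ :=
  H →ₗ[ℝ] (Ω →ₘ[P] ℝ)

/-- Continuity of a cylindrical random variable `H → L⁰(Ω, P)`, where `L⁰` carries the topology
of convergence in probability. -/
def CylindricalRV.IsContinuous {Ω : Type*} [MeasurableSpace Ω] {H : Type*} [NormedAddCommGroup H]
    [InnerProductSpace ℝ H] {P : Measure Ω} (Y : CylindricalRV H P) : Prop :=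
  ∀ h : H, TendstoInMeasure P (fun (h' : H) (ω : Ω) => Y h' ω) (𝓝 h) (fun ω => Y h ω)

/-- A cylindrical square integrable martingale: for every `h`, the real process `(M t h)` is a
square integrable martingale. (When the σ-algebras of the filtration contain all null sets, this
does not depend on the representatives of the classes `M t h`.) -/
def IsCylindricalSquareIntegrableMartingale {Ω J H : Type*} [Preorder J] {m : MeasurableSpace Ω}
    [NormedAddCommGroup H] [InnerProductSpace ℝ H] {P : Measure Ω}
    (M : J → CylindricalRV H P) (𝓕 : Filtration J m) : Prop :=
  ∀ h : H, IsSquareIntegrableMartingale (fun (t : J) (ω : Ω) => M t h ω) 𝓕 P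

/-- The cylindrical process `M ∘ S* = (M t ∘ S*)` in `G`. -/
noncomputable def cylindricalCompAdjoint {Ω J H G : Type*} [MeasurableSpace Ω]
    [NormedAddCommGroup H] [InnerProductSpace ℝ H] [CompleteSpace H]
    [NormedAddCommGroup G] [InnerProductSpace ℝ G] [CompleteSpace G] {P : Measure Ω}
    (M : J → CylindricalRV H P) (S : H →L[ℝ] G) : J → CylindricalRV G P :=
  fun t => (M t).comp (ContinuousLinearMap.adjoint S : G →L[ℝ] H).toLinearMap

/-- The `G`-valued process `X` is a version of the cylindrical process `Y` in `G`:
for all `t` and `g`, almost surely `⟨X t, g⟩ = Y t g`. -/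
def IsVersionOf {Ω J G : Type*} [MeasurableSpace Ω] [NormedAddCommGroup G]
    [InnerProductSpace ℝ G] {P : Measure Ω}
    (X : J → Ω → G) (Y : J → CylindricalRV G P) : Prop :=
  ∀ (t : J) (g : G), ∀ᵐ ω ∂P, inner ℝ (X t ω) g = Y t g ω

/-!
Continuity of `M τ : H → L⁰` at the final time `τ` improves, by the closed graph theorem, to
continuity as a map into `L²`. Since `S` is Hilbert-Schmidt, `A = M τ ∘ S*` has square-summable
norms along an orthonormal basis `b` of `G`, so the orthogonal series `Z = ∑ A (b k) • b k`
converges in `L²(Ω; G)` and `⟨Z, g⟩ = A g`. The martingale `Y t = P[Z | 𝓕 t]` then represents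
`M t ∘ S*` at every time.

To regularise `Y`, read it along a finite set of times and mark a time whenever `Y` has moved by
`ε` since the last mark. The increments of a martingale are orthogonal, so the expected number of
marks is at most `∫ ‖Z‖² / ε²`, whatever the set of times. Hence almost every path has finitely
many oscillations of each size along a countable dense set `D`, and so has one-sided limits along
`D`. The right limits form a càdlàg process, which is a modification of `Y` by uniform integrability
and right continuity of the filtration.
-/

/-- A list of times along which the path `f` oscillates: the list is strictly increasing, and `f`
moves by at least `δ` between any two of its consecutive entries. -/
def IsOscillationChain {J E : Type*} [Preorder J] [PseudoMetricSpace E] (f : J → E) (δ : ℝ)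
    (L : List J) : Prop :=
  L.IsChain fun a b => a < b ∧ δ ≤ dist (f a) (f b)

/-- The path `f` has, for every `δ > 0`, a bounded number of oscillations of size `δ` along the set
of times `D`. This is the pathwise regularity from which one-sided limits along `D` are obtained. -/
def HasFiniteOscillationsOn {J E : Type*} [Preorder J] [PseudoMetricSpace E] (f : J → E)
    (D : Set J) : Prop :=
  ∀ δ > 0, ∃ n : ℕ, ∀ L : List J, (∀ a ∈ L, a ∈ D) → IsOscillationChain f δ L → L.length ≤ n

theorem IsOscillationChain.anti {J E : Type*} [Preorder J] [PseudoMetricSpace E] {f : J → E}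
    {δ δ' : ℝ} (hδ : δ ≤ δ') {L : List J} (hL : IsOscillationChain f δ' L) :
    IsOscillationChain f δ L :=
  hL.imp fun _ _ h => ⟨h.1, hδ.trans h.2⟩

namespace HasFiniteOscillationsOn

section OneSidedLimits

variable {J E : Type*} [Preorder J] [PseudoMetricSpace E] {f : J → E} {D : Set J}

theorem comp_ofDual (hf : HasFiniteOscillationsOn f D) :
    HasFiniteOscillationsOn (f ∘ OrderDual.ofDual) (OrderDual.ofDual ⁻¹' D) := by
  intro δ hδ
  obtain ⟨n, hn⟩ := hf δ hδ
  refine ⟨n, fun L hLD hL => ?_⟩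
  rw [← L.length_map OrderDual.ofDual, ← List.length_reverse]
  refine hn _ (fun a ha => ?_) (List.isChain_reverse.2 ((List.isChain_map _).2 ?_))
  · obtain ⟨b, hb, rfl⟩ := List.mem_map.1 (List.mem_reverse.1 ha)
    exact hLD b hb
  · exact hL.imp fun a b h => ⟨h.1, by rw [dist_comm]; exact h.2⟩

theorem cauchy_map_of_eventually_lt (hf : HasFiniteOscillationsOn f D) {l : Filter J} [l.NeBot]
    (hD : D ∈ l) (hl : ∀ᶠ p in l, ∀ᶠ q in l, q < p) : Cauchy (map f l) := by
  refine Metric.cauchy_iff.2 ⟨inferInstance, fun ε hε => ?_⟩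
  obtain ⟨n, hn⟩ := hf (ε / 2) (half_pos hε)
  by_contra! H
  have far_point : ∀ p, ∀ U ∈ l, ∃ q ∈ U, ε / 2 ≤ dist (f q) (f p) := by
    intro p U hU
    obtain ⟨_, ⟨b, hb, rfl⟩, _, ⟨c, hc, rfl⟩, hbc⟩ := H _ (image_mem_map hU)
    by_contra! hfar
    linarith [hfar b hb, hfar c hc, dist_triangle_right (f b) (f c) (f p)]
  have long_chain : ∀ k : ℕ, ∃ p L, L.length = k ∧ (∀ᶠ q in l, q < p) ∧
      (∀ a ∈ p :: L, a ∈ D) ∧ IsOscillationChain f (ε / 2) (p :: L) := by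
    intro k
    induction k with
    | zero =>
      obtain ⟨p, hp, hpD⟩ := (hl.and hD).exists
      exact ⟨p, [], rfl, hp, List.forall_mem_singleton.2 hpD, .singleton p⟩
    | succ k ih =>
      obtain ⟨p, L, hk, hp, hpD, hL⟩ := ih
      obtain ⟨q, ⟨hqp, hq, hqD⟩, hd⟩ := far_point p _ (hp.and (hl.and hD))
      exact ⟨q, p :: L, by simp [hk], hq, List.forall_mem_cons.2 ⟨hqD, hpD⟩,
        .cons_cons ⟨hqp, hd⟩ hL⟩
  obtain ⟨p, L, hk, -, hpD, hL⟩ := long_chain n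
  have := hn _ hpD hL
  simp [hk] at this

theorem cauchy_map_of_eventually_gt (hf : HasFiniteOscillationsOn f D) {l : Filter J} [l.NeBot]
    (hD : D ∈ l) (hl : ∀ᶠ p in l, ∀ᶠ q in l, p < q) : Cauchy (map f l) :=
  have : NeBot (α := Jᵒᵈ) l := ‹l.NeBot›
  hf.comp_ofDual.cauchy_map_of_eventually_lt (l := l) hD hl

end OneSidedLimits

end HasFiniteOscillationsOn

theorem tendsto_nhdsWithin_of_forall_mapClusterPt {X Y : Type*} [TopologicalSpace X]
    [TopologicalSpace Y] [RegularSpace Y] {f r : X → Y} {U D : Set X} (hU : IsOpen U) {t : X}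
    {y : Y} (hf : Tendsto f (𝓝[U ∩ D] t) (𝓝 y))
    (hr : ∀ s ∈ U, MapClusterPt (r s) (𝓝[D] s) f) : Tendsto r (𝓝[U] t) (𝓝 y) := by
  refine (closed_nhds_basis y).tendsto_right_iff.2 fun V ⟨hVy, hV⟩ => ?_
  have hfV : ∀ᶠ x in 𝓝[U] t, x ∈ D → f x ∈ V := by
    have h := eventually_nhdsWithin_iff.1 (hf hVy)
    refine eventually_nhdsWithin_iff.2 (h.mono fun x hx hxU hxD => hx ⟨hxU, hxD⟩)
  filter_upwards [eventually_eventually_nhdsWithin.2 hfV, self_mem_nhdsWithin] with s hs hsU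
  rw [hU.nhdsWithin_eq hsU] at hs
  exact hV.mem_of_mapClusterPt (hr s hsU) (eventually_nhdsWithin_iff.2 hs)

section RightLimits

variable {J E : Type*} [LinearOrder J] [TopologicalSpace J]

open Classical in
/-- The right limit of `f` at `t` along the set of times `D`; where `t` is isolated on the right,
this is `f t` by convention. -/
noncomputable def rightLimAlong [TopologicalSpace E] [Nonempty E] (D : Set J) (f : J → E)
    (t : J) : E :=
  if 𝓝[>] t = ⊥ then f t else limUnder (𝓝[Set.Ioi t ∩ D] t) f

variable [OrderTopology J] {D : Set J} {t : J}

theorem exists_countable_dense_of_nhdsGT_eq_bot (J : Type*) [LinearOrder J] [TopologicalSpace J]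
    [OrderTopology J] [SecondCountableTopology J] :
    ∃ D : Set J, D.Countable ∧ Dense D ∧ ∀ t, 𝓝[>] t = ⊥ → t ∈ D := by
  obtain ⟨D, hDc, hD⟩ := TopologicalSpace.exists_countable_dense J
  exact ⟨D ∪ {t | 𝓝[>] t = ⊥}, hDc.union countable_setOfPred_isolated_right,
    hD.mono Set.subset_union_left, fun t ht => Or.inr ht⟩

theorem neBot_nhdsWithin_Ioi_inter (hD : Dense D) [h : (𝓝[>] t).NeBot] :
    (𝓝[Set.Ioi t ∩ D] t).NeBot := by
  rw [← mem_closure_iff_nhdsWithin_neBot] at h ⊢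
  exact closure_minimal (hD.open_subset_closure_inter isOpen_Ioi) isClosed_closure h

namespace HasFiniteOscillationsOn

variable [PseudoMetricSpace E] [CompleteSpace E] {f : J → E}

theorem exists_tendsto_nhdsWithin_Iio [Nonempty E] (hf : HasFiniteOscillationsOn f D) (t : J) :
    ∃ y, Tendsto f (𝓝[Set.Iio t ∩ D] t) (𝓝 y) := by
  rcases (𝓝[Set.Iio t ∩ D] t).eq_or_neBot with h | h
  · exact ⟨Classical.arbitrary E, h ▸ tendsto_bot⟩
  refine CompleteSpace.complete (hf.cauchy_map_of_eventually_gt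
    (mem_of_superset self_mem_nhdsWithin Set.inter_subset_right) ?_)
  filter_upwards [self_mem_nhdsWithin] with p hp
  exact mem_nhdsWithin_of_mem_nhds (Ioi_mem_nhds hp.1)

variable [Nonempty E]

theorem tendsto_rightLimAlong (hf : HasFiniteOscillationsOn f D) (hD : Dense D)
    [h : (𝓝[>] t).NeBot] : Tendsto f (𝓝[Set.Ioi t ∩ D] t) (𝓝 (rightLimAlong D f t)) := by
  have := neBot_nhdsWithin_Ioi_inter hD (t := t)
  rw [rightLimAlong, if_neg h.ne]
  refine tendsto_nhds_limUnder (CompleteSpace.complete (hf.cauchy_map_of_eventually_lt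
    (mem_of_superset self_mem_nhdsWithin Set.inter_subset_right) ?_))
  filter_upwards [self_mem_nhdsWithin] with p hp
  exact mem_nhdsWithin_of_mem_nhds (Iio_mem_nhds hp.1)

theorem mapClusterPt_rightLimAlong (hf : HasFiniteOscillationsOn f D) (hD : Dense D)
    (hDt : 𝓝[>] t = ⊥ → t ∈ D) : MapClusterPt (rightLimAlong D f t) (𝓝[D] t) f := by
  rcases (𝓝[>] t).eq_or_neBot with h | h
  · have : pure t ≤ 𝓝[D] t := pure_le_nhdsWithin (hDt h)
    rw [rightLimAlong, if_pos h]
    exact (tendsto_pure_nhds f t).mapClusterPt.mono this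
  · have := neBot_nhdsWithin_Ioi_inter hD (t := t)
    exact (hf.tendsto_rightLimAlong hD).mapClusterPt.mono
      (nhdsWithin_mono t Set.inter_subset_right)

theorem isCadlagPath_rightLimAlong (hf : HasFiniteOscillationsOn f D) (hD : Dense D)
    (hD' : ∀ t, 𝓝[>] t = ⊥ → t ∈ D) : IsCadlagPath (rightLimAlong D f) := by
  intro t
  have hcluster : ∀ s, MapClusterPt (rightLimAlong D f s) (𝓝[D] s) f :=
    fun s => hf.mapClusterPt_rightLimAlong hD (hD' s)
  constructor
  · rw [← continuousWithinAt_Ioi_iff_Ici]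
    rcases (𝓝[>] t).eq_or_neBot with h | h
    · simp only [ContinuousWithinAt, h, tendsto_bot]
    · exact tendsto_nhdsWithin_of_forall_mapClusterPt isOpen_Ioi (hf.tendsto_rightLimAlong hD)
        fun s _ => hcluster s
  · obtain ⟨y, hy⟩ := hf.exists_tendsto_nhdsWithin_Iio t
    exact ⟨y, tendsto_nhdsWithin_of_forall_mapClusterPt isOpen_Iio hy fun s _ => hcluster s⟩

end HasFiniteOscillationsOn

end RightLimits

section GreedyMarking

variable {E : Type*} [PseudoMetricSpace E]

/-- Reading the sequence `x`, one marks `x 0` and then every term at distance at least `ε` from the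
term marked last; `lastMark ε x k` is the term marked last up to time `k`. -/
noncomputable def lastMark (ε : ℝ) (x : ℕ → E) : ℕ → E
  | 0 => x 0
  | k + 1 => open Classical in
    if ε ≤ dist (x (k + 1)) (lastMark ε x k) then x (k + 1) else lastMark ε x k

open Classical in
/-- The number of terms of the sequence `x` marked after time `0` and up to time `k`, in the sense
of `lastMark`. -/
noncomputable def markCount (ε : ℝ) (x : ℕ → E) (k : ℕ) : ℕ :=
  Nat.count (fun i => ε ≤ dist (x (i + 1)) (lastMark ε x i)) k

variable {ε : ℝ} (x : ℕ → E)

theorem markCount_mono (ε : ℝ) : Monotone (markCount ε x) :=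
  Nat.count_monotone _

theorem markCount_le (ε : ℝ) (k : ℕ) : markCount ε x k ≤ k :=
  Nat.count_le _

open Classical in
theorem markCount_succ (ε : ℝ) (k : ℕ) : markCount ε x (k + 1) =
    markCount ε x k + if ε ≤ dist (x (k + 1)) (lastMark ε x k) then 1 else 0 :=
  Nat.count_succ _ _

theorem dist_lastMark_lt (hε : 0 < ε) (k : ℕ) : dist (x k) (lastMark ε x k) < ε := by
  cases k with
  | zero => simpa only [lastMark, dist_self] using hε
  | succ k =>
    rw [lastMark]
    split_ifs with h
    · rwa [dist_self]
    · exact not_le.1 h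

variable {x}

theorem lastMark_eq_of_markCount_eq {j k : ℕ} (hjk : j ≤ k)
    (h : markCount ε x k = markCount ε x j) : lastMark ε x k = lastMark ε x j := by
  induction k, hjk using Nat.le_induction with
  | base => rfl
  | succ k hjk ih =>
    have hjk := markCount_mono x ε hjk
    rw [markCount_succ] at h
    rw [lastMark]
    split_ifs at h ⊢
    · omega
    · exact ih h

theorem markCount_lt_of_le_dist (hε : 0 < ε) {j k : ℕ} (hjk : j ≤ k)
    (hd : 2 * ε ≤ dist (x j) (x k)) : markCount ε x j < markCount ε x k := by
  refine (markCount_mono x ε hjk).lt_of_ne fun h => hd.not_gt ?_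
  calc dist (x j) (x k)
      ≤ dist (x j) (lastMark ε x j) + dist (x k) (lastMark ε x k) := by
        rw [lastMark_eq_of_markCount_eq hjk h.symm]
        exact dist_triangle_right _ _ _
    _ < 2 * ε := by linarith [dist_lastMark_lt x hε j, dist_lastMark_lt x hε k]

theorem dist_lastMark_succ_sq_add_markCount_le (hε : 0 ≤ ε) (k : ℕ) :
    dist (x (k + 1)) (lastMark ε x (k + 1)) ^ 2 + ε ^ 2 * markCount ε x (k + 1) ≤
      dist (x (k + 1)) (lastMark ε x k) ^ 2 + ε ^ 2 * markCount ε x k := by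
  rw [lastMark, markCount_succ]
  split_ifs with h
  · have : ε ^ 2 ≤ dist (x (k + 1)) (lastMark ε x k) ^ 2 := by gcongr
    rw [dist_self]
    push_cast
    linarith
  · simp

theorem IsOscillationChain.add_length_le_markCount {J : Type*} [LinearOrder J] {f : J → E}
    (hε : 0 < ε) {τ : ℕ → J} (hτ : Monotone τ) {N : ℕ} {L : List J}
    (hLτ : ∀ a ∈ L, a ∈ τ '' Set.Iic N) {i : ℕ} (hi : i ≤ N)
    (hL : IsOscillationChain f (2 * ε) (τ i :: L)) :
    markCount ε (f ∘ τ) i + L.length ≤ markCount ε (f ∘ τ) N := by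
  induction L generalizing i with
  | nil => exact markCount_mono _ ε hi
  | cons a L ih =>
    obtain ⟨⟨j, hj, rfl⟩, hL'τ⟩ := List.forall_mem_cons.1 hLτ
    obtain ⟨⟨hij, hd⟩, hL⟩ := List.isChain_cons_cons.1 hL
    have h1 := markCount_lt_of_le_dist (x := f ∘ τ) hε (hτ.reflect_lt hij).le hd
    have h2 := ih hL'τ hj hL
    rw [List.length_cons]
    omega

end GreedyMarking

section DiscreteTime

variable {Ω E : Type*} {m : MeasurableSpace Ω} {P : Measure Ω} [NormedAddCommGroup E]

section Measurability

variable {𝓖 : Filtration ℕ m} {X : ℕ → Ω → E}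

theorem stronglyMeasurable_lastMark (hX : StronglyAdapted 𝓖 X) (ε : ℝ) (k : ℕ) :
    StronglyMeasurable[𝓖 k] fun ω => lastMark ε (X · ω) k := by
  classical
  induction k with
  | zero => exact hX 0
  | succ k ih =>
    have ih := ih.mono (𝓖.mono k.le_succ)
    simp only [lastMark]
    exact .ite (stronglyMeasurable_const.measurableSet_le ((hX (k + 1)).dist ih)) (hX (k + 1)) ih

theorem memLp_lastMark {p : ℝ≥0∞} (hX : StronglyAdapted 𝓖 X) (hXp : ∀ k, MemLp (X k) p P)
    (ε : ℝ) (k : ℕ) : MemLp (fun ω => lastMark ε (X · ω) k) p P := by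
  induction k with
  | zero => exact hXp 0
  | succ k ih =>
    refine ((hXp (k + 1)).norm.add ih.norm).mono
      ((stronglyMeasurable_lastMark hX ε _).mono (𝓖.le _)).aestronglyMeasurable
      (ae_of_all _ fun ω => ?_)
    rw [lastMark, Pi.add_apply, Real.norm_of_nonneg (by positivity)]
    split_ifs <;> simp

theorem integrable_markCount [IsFiniteMeasure P] (hX : StronglyAdapted 𝓖 X) (ε : ℝ) (k : ℕ) :
    Integrable (fun ω => (markCount ε (X · ω) k : ℝ)) P := by
  classical
  suffices StronglyMeasurable fun ω => (markCount ε (X · ω) k : ℝ) from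
    .of_bound this.aestronglyMeasurable k (ae_of_all _ fun ω => by
      simpa using markCount_le (X · ω) ε k)
  induction k with
  | zero => simpa [markCount] using stronglyMeasurable_const
  | succ k ih =>
    have hmark : StronglyMeasurable fun ω => lastMark ε (X · ω) k :=
      (stronglyMeasurable_lastMark hX ε k).mono (𝓖.le k)
    have hX' : StronglyMeasurable (X (k + 1)) := (hX (k + 1)).mono (𝓖.le _)
    simp only [markCount_succ, Nat.cast_add, Nat.cast_ite, Nat.cast_one, Nat.cast_zero]
    exact ih.add (.ite (stronglyMeasurable_const.measurableSet_le (hX'.dist hmark))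
      stronglyMeasurable_const stronglyMeasurable_const)

end Measurability

variable [InnerProductSpace ℝ E]

theorem integrable_inner_of_memLp_two {f g : Ω → E} (hf : MemLp f 2 P) (hg : MemLp g 2 P) :
    Integrable (fun ω => inner ℝ (f ω) (g ω)) P :=
  hf.norm.integrable_mul hg.norm |>.mono' (hf.1.inner hg.1)
    (ae_of_all _ fun _ => norm_inner_le_norm _ _)

namespace IsSquareIntegrableMartingale

variable [CompleteSpace E] [IsFiniteMeasure P]

section Orthogonality

variable {J : Type*} [Preorder J] {𝓕 : Filtration J m} {X : J → Ω → E} {i j : J} {Y : Ω → E}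

theorem integral_inner_eq (hX : IsSquareIntegrableMartingale X 𝓕 P) (hij : i ≤ j)
    (hY : StronglyMeasurable[𝓕 i] Y) (hY2 : MemLp Y 2 P) :
    ∫ ω, inner ℝ (X j ω) (Y ω) ∂P = ∫ ω, inner ℝ (X i ω) (Y ω) ∂P := by
  have pull_out : P[fun ω => inner ℝ (X j ω) (Y ω) | 𝓕 i] =ᵐ[P]
      fun ω => inner ℝ ((P[X j | 𝓕 i]) ω) (Y ω) :=
    condExp_bilin_of_stronglyMeasurable_right (innerSL ℝ) hY
      (integrable_inner_of_memLp_two (hX.2 j) hY2) (hX.1.integrable j)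
  rw [← integral_condExp (𝓕.le i)]
  refine integral_congr_ae ?_
  filter_upwards [pull_out, hX.1.condExp_ae_eq hij] with ω h1 h2
  rw [h1, h2]

theorem integral_norm_sub_sq (hX : IsSquareIntegrableMartingale X 𝓕 P) (hij : i ≤ j)
    (hY : StronglyMeasurable[𝓕 i] Y) (hY2 : MemLp Y 2 P) :
    ∫ ω, ‖X j ω - Y ω‖ ^ 2 ∂P - ∫ ω, ‖X i ω - Y ω‖ ^ 2 ∂P =
      ∫ ω, ‖X j ω‖ ^ 2 ∂P - ∫ ω, ‖X i ω‖ ^ 2 ∂P := by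
  have expand : ∀ k, ∫ ω, ‖X k ω - Y ω‖ ^ 2 ∂P =
      ∫ ω, ‖X k ω‖ ^ 2 ∂P - 2 * ∫ ω, inner ℝ (X k ω) (Y ω) ∂P + ∫ ω, ‖Y ω‖ ^ 2 ∂P := by
    intro k
    have hXX := (hX.2 k).integrable_norm_pow two_ne_zero
    have hXY := (integrable_inner_of_memLp_two (hX.2 k) hY2).const_mul 2
    have hsub : Integrable (fun ω => ‖X k ω‖ ^ 2 - 2 * inner ℝ (X k ω) (Y ω)) P := hXX.sub hXY
    simp_rw [norm_sub_sq_real]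
    rw [integral_add hsub (hY2.integrable_norm_pow two_ne_zero), integral_sub hXX hXY,
      integral_const_mul]
  rw [expand, expand, hX.integral_inner_eq hij hY hY2]
  ring

theorem monotone_integral_norm_sq (hX : IsSquareIntegrableMartingale X 𝓕 P) :
    Monotone fun t => ∫ ω, ‖X t ω‖ ^ 2 ∂P := by
  intro i j hij
  have h := hX.integral_norm_sub_sq hij (hX.1.1 i) (hX.2 i)
  simp only [sub_self, norm_zero, zero_pow two_ne_zero, integral_zero, sub_zero] at h
  exact sub_nonneg.1 (h ▸ integral_nonneg fun ω => sq_nonneg _)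

end Orthogonality

variable {𝓖 : Filtration ℕ m} {X : ℕ → Ω → E} {ε : ℝ}

-- The distance to the last mark starts afresh at every new mark, and by orthogonality of the
-- increments each mark costs at least `ε ^ 2` of the energy `∫ ‖X k‖ ^ 2`.
theorem integral_norm_sub_lastMark_sq_add_le (hX : IsSquareIntegrableMartingale X 𝓖 P)
    (hε : 0 ≤ ε) (k : ℕ) :
    ∫ ω, (‖X k ω - lastMark ε (X · ω) k‖ ^ 2 + ε ^ 2 * markCount ε (X · ω) k) ∂P ≤
      ∫ ω, ‖X k ω‖ ^ 2 ∂P := by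
  have hmark := memLp_lastMark hX.1.1 hX.2 ε
  have hcount := fun j => (integrable_markCount (P := P) hX.1.1 ε j).const_mul (ε ^ 2)
  have hdist : ∀ i j, Integrable (fun ω => ‖X i ω - lastMark ε (X · ω) j‖ ^ 2) P :=
    fun i j => ((hX.2 i).sub (hmark j)).integrable_norm_pow two_ne_zero
  induction k with
  | zero => simpa [lastMark, markCount] using integral_nonneg fun ω => sq_nonneg ‖X 0 ω‖
  | succ k ih =>
    have energy := hX.integral_norm_sub_sq k.le_succ
      (stronglyMeasurable_lastMark hX.1.1 ε k) (hmark k)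
    calc ∫ ω, (‖X (k + 1) ω - lastMark ε (X · ω) (k + 1)‖ ^ 2 +
            ε ^ 2 * markCount ε (X · ω) (k + 1)) ∂P
        ≤ ∫ ω, (‖X (k + 1) ω - lastMark ε (X · ω) k‖ ^ 2 +
            ε ^ 2 * markCount ε (X · ω) k) ∂P := by
          refine integral_mono ((hdist _ _).add (hcount _)) ((hdist _ _).add (hcount _)) fun ω => ?_
          simpa only [dist_eq_norm] using
            dist_lastMark_succ_sq_add_markCount_le (x := (X · ω)) hε k
      _ = ∫ ω, (‖X k ω - lastMark ε (X · ω) k‖ ^ 2 + ε ^ 2 * markCount ε (X · ω) k) ∂P +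
            (∫ ω, ‖X (k + 1) ω‖ ^ 2 ∂P - ∫ ω, ‖X k ω‖ ^ 2 ∂P) := by
          rw [integral_add (hdist _ _) (hcount _), integral_add (hdist _ _) (hcount _), ← energy]
          ring
      _ ≤ ∫ ω, ‖X (k + 1) ω‖ ^ 2 ∂P := by linarith

theorem integral_markCount_le (hX : IsSquareIntegrableMartingale X 𝓖 P) (hε : 0 < ε) (k : ℕ) :
    ∫ ω, (markCount ε (X · ω) k : ℝ) ∂P ≤ (∫ ω, ‖X k ω‖ ^ 2 ∂P) / ε ^ 2 := by
  rw [le_div_iff₀' (by positivity), ← integral_const_mul]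
  refine le_trans (integral_mono_of_nonneg (ae_of_all _ fun ω => by positivity) ?_
    (ae_of_all _ fun ω => ?_)) (hX.integral_norm_sub_lastMark_sq_add_le hε.le k)
  · exact (((hX.2 k).sub (memLp_lastMark hX.1.1 hX.2 ε k)).integrable_norm_pow two_ne_zero).add
      ((integrable_markCount hX.1.1 ε k).const_mul _)
  · exact le_add_of_nonneg_left (sq_nonneg _)

theorem measure_le_markCount_le (hX : IsSquareIntegrableMartingale X 𝓖 P) (hε : 0 < ε) (k : ℕ)
    {n : ℕ} (hn : n ≠ 0) :
    P {ω | n ≤ markCount ε (X · ω) k} ≤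
      ENNReal.ofReal ((∫ ω, ‖X k ω‖ ^ 2 ∂P) / ε ^ 2 / n) := by
  have markov := mul_meas_ge_le_integral_of_nonneg (μ := P)
    (ae_of_all _ fun ω => Nat.cast_nonneg _) (integrable_markCount hX.1.1 ε k) (n : ℝ)
  simp only [Nat.cast_le] at markov
  rw [← ofReal_measureReal]
  refine ENNReal.ofReal_le_ofReal ((le_div_iff₀' (by positivity)).2 ?_)
  exact markov.trans (hX.integral_markCount_le hε k)

end IsSquareIntegrableMartingale

end DiscreteTime

section ContinuousTime

theorem exists_monotone_image_Iic_eq {J : Type*} [LinearOrder J] (F : Finset J)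
    (hF : F.Nonempty) : ∃ (N : ℕ) (τ : ℕ → J), Monotone τ ∧ τ '' Set.Iic N = F := by
  obtain ⟨N, hN⟩ := Nat.exists_eq_add_one_of_ne_zero hF.card_pos.ne'
  refine ⟨N, fun k => F.orderEmbOfFin hN (Fin.clamp k N),
    (F.orderEmbOfFin hN).monotone.comp Fin.clamp_monotone, ?_⟩
  rw [← F.range_orderEmbOfFin hN]
  refine subset_antisymm (Set.image_subset_iff.2 fun k _ => Set.mem_range_self _) ?_
  rintro _ ⟨i, rfl⟩
  refine ⟨i, Nat.lt_succ_iff.1 i.2, congrArg _ (Fin.ext ?_)⟩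
  simpa using Nat.lt_succ_iff.1 i.2

/-- The filtration read along an increasing family of times. It turns a martingale in continuous
time, sampled at finitely many times, into a martingale in discrete time. -/
def filtrationAlong {Ω I J : Type*} [Preorder I] [Preorder J] {m : MeasurableSpace Ω}
    (𝓕 : Filtration J m) {τ : I → J} (hτ : Monotone τ) : Filtration I m where
  seq i := 𝓕 (τ i)
  mono' _ _ h := 𝓕.mono (hτ h)
  le' i := 𝓕.le (τ i)

namespace IsSquareIntegrableMartingale

variable {Ω J E : Type*} {m : MeasurableSpace Ω} {P : Measure Ω} [NormedAddCommGroup E]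
  [InnerProductSpace ℝ E] [CompleteSpace E]

theorem comp_monotone {I : Type*} [Preorder I] [Preorder J] {𝓕 : Filtration J m} {X : J → Ω → E}
    (hX : IsSquareIntegrableMartingale X 𝓕 P) {τ : I → J} (hτ : Monotone τ) :
    IsSquareIntegrableMartingale (X ∘ τ) (filtrationAlong 𝓕 hτ) P :=
  ⟨⟨fun i => hX.1.1 (τ i), fun _ _ h => hX.1.2 _ _ (hτ h)⟩, fun i => hX.2 (τ i)⟩

variable [IsFiniteMeasure P] [LinearOrder J] {𝓕 : Filtration J m} {X : J → Ω → E} {C ε : ℝ}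

theorem measure_exists_isOscillationChain_finset_le (hX : IsSquareIntegrableMartingale X 𝓕 P)
    (hC : ∀ t, ∫ ω, ‖X t ω‖ ^ 2 ∂P ≤ C) (F : Finset J) (hε : 0 < ε) {n : ℕ} (hn : n ≠ 0) :
    P {ω | ∃ L, (∀ a ∈ L, a ∈ F) ∧ IsOscillationChain (X · ω) (2 * ε) L ∧ n < L.length} ≤
      ENNReal.ofReal (C / ε ^ 2 / n) := by
  rcases F.eq_empty_or_nonempty with rfl | hF
  · simp +contextual [← List.eq_nil_iff_forall_not_mem]
  obtain ⟨N, τ, hτ, hτF⟩ := exists_monotone_image_Iic_eq F hF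
  calc P {ω | ∃ L, (∀ a ∈ L, a ∈ F) ∧ IsOscillationChain (X · ω) (2 * ε) L ∧ n < L.length}
      ≤ P {ω | n ≤ markCount ε (fun i => X (τ i) ω) N} := by
        refine measure_mono ?_
        rintro ω ⟨_ | ⟨a, L⟩, hLF, hL, hnL⟩
        · exact absurd hnL (Nat.not_lt_zero n)
        simp only [← Finset.mem_coe, ← hτF] at hLF
        obtain ⟨⟨i, hi, rfl⟩, hLτ⟩ := List.forall_mem_cons.1 hLF
        have hcount := hL.add_length_le_markCount hε hτ hLτ hi
        exact (Nat.le_of_lt_succ hnL).trans ((Nat.le_add_left _ _).trans hcount)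
    _ ≤ ENNReal.ofReal ((∫ ω, ‖X (τ N) ω‖ ^ 2 ∂P) / ε ^ 2 / n) :=
        (hX.comp_monotone hτ).measure_le_markCount_le hε N hn
    _ ≤ ENNReal.ofReal (C / ε ^ 2 / n) := by gcongr; exact hC _

variable {D : Set J}

theorem measure_exists_isOscillationChain_le (hX : IsSquareIntegrableMartingale X 𝓕 P)
    (hC : ∀ t, ∫ ω, ‖X t ω‖ ^ 2 ∂P ≤ C) (hD : D.Countable) (hε : 0 < ε) {n : ℕ} (hn : n ≠ 0) :
    P {ω | ∃ L, (∀ a ∈ L, a ∈ D) ∧ IsOscillationChain (X · ω) (2 * ε) L ∧ n < L.length} ≤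
      ENNReal.ofReal (C / ε ^ 2 / n) := by
  classical
  have : Countable D := hD.to_subtype
  let B : Finset D → Set Ω := fun F => {ω | ∃ L, (∀ a ∈ L, a ∈ F.map (.subtype (· ∈ D))) ∧
    IsOscillationChain (X · ω) (2 * ε) L ∧ n < L.length}
  have hB : Monotone B := fun F F' hF ω ⟨L, hLF, hL⟩ =>
    ⟨L, fun a ha => Finset.map_subset_map.2 hF (hLF a ha), hL⟩
  calc P {ω | ∃ L, (∀ a ∈ L, a ∈ D) ∧ IsOscillationChain (X · ω) (2 * ε) L ∧ n < L.length}
      ≤ P (⋃ F, B F) := by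
        refine measure_mono ?_
        rintro ω ⟨L, hLD, hL⟩
        refine Set.mem_iUnion.2 ⟨L.toFinset.subtype (· ∈ D), L, fun a ha => ?_, hL⟩
        simpa using ⟨ha, hLD a ha⟩
    _ = ⨆ F, P (B F) := hB.directed_le.measure_iUnion
    _ ≤ ENNReal.ofReal (C / ε ^ 2 / n) :=
        iSup_le fun F => hX.measure_exists_isOscillationChain_finset_le hC _ hε hn

theorem ae_exists_forall_isOscillationChain_length_le (hX : IsSquareIntegrableMartingale X 𝓕 P)
    (hC : ∀ t, ∫ ω, ‖X t ω‖ ^ 2 ∂P ≤ C) (hD : D.Countable) {δ : ℝ} (hδ : 0 < δ) :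
    ∀ᵐ ω ∂P, ∃ n : ℕ, ∀ L : List J, (∀ a ∈ L, a ∈ D) →
      IsOscillationChain (X · ω) δ L → L.length ≤ n := by
  rw [ae_iff, ← nonpos_iff_eq_zero]
  have hlim : Tendsto (fun n : ℕ => ENNReal.ofReal (C / (δ / 2) ^ 2 / n)) atTop (𝓝 0) := by
    simpa using ENNReal.tendsto_ofReal (tendsto_const_div_atTop_nhds_zero_nat (C / (δ / 2) ^ 2))
  refine ge_of_tendsto hlim ((eventually_ne_atTop 0).mono fun n hn => ?_)
  refine (measure_mono fun ω hω => ?_).trans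
    (hX.measure_exists_isOscillationChain_le hC hD (half_pos hδ) hn)
  rw [mul_div_cancel₀ δ two_ne_zero]
  simp only [Set.mem_ofPred_eq, not_exists, not_forall, not_le] at hω
  obtain ⟨L, hLD, hL, hn⟩ := hω n
  exact ⟨L, hLD, hL, hn⟩

theorem ae_hasFiniteOscillationsOn (hX : IsSquareIntegrableMartingale X 𝓕 P)
    (hC : ∀ t, ∫ ω, ‖X t ω‖ ^ 2 ∂P ≤ C) (hD : D.Countable) :
    ∀ᵐ ω ∂P, HasFiniteOscillationsOn (X · ω) D := by
  have h : ∀ᵐ ω ∂P, ∀ k : ℕ, ∃ n : ℕ, ∀ L : List J, (∀ a ∈ L, a ∈ D) →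
      IsOscillationChain (X · ω) (1 / (k + 1)) L → L.length ≤ n :=
    ae_all_iff.2 fun k =>
      hX.ae_exists_forall_isOscillationChain_length_le hC hD Nat.one_div_pos_of_nat
  filter_upwards [h] with ω hω δ hδ
  obtain ⟨k, hk⟩ := exists_nat_one_div_lt hδ
  obtain ⟨n, hn⟩ := hω k
  exact ⟨n, fun L hLD hL => hn L hLD (hL.anti hk.le)⟩

end IsSquareIntegrableMartingale

end ContinuousTime

section UniformIntegrability

variable {Ω ι E : Type*} {m : MeasurableSpace Ω} {P : Measure Ω} [NormedAddCommGroup E]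

theorem uniformIntegrable_of_ae_norm_le {F : Type*} [NormedAddCommGroup F] {p : ℝ≥0∞}
    {f : ι → Ω → E} {g : ι → Ω → F} (hf : ∀ i, AEStronglyMeasurable (f i) P)
    (hg : UniformIntegrable g p P) (hfg : ∀ i, ∀ᵐ ω ∂P, ‖f i ω‖ ≤ ‖g i ω‖) :
    UniformIntegrable f p P := by
  obtain ⟨-, hunif, C, hC⟩ := hg
  refine ⟨hf, fun ε hε => ?_, C, fun i => (eLpNorm_mono_ae (hfg i)).trans (hC i)⟩
  obtain ⟨δ, hδ, hδε⟩ := hunif hε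
  refine ⟨δ, hδ, fun i s hs hPs => (eLpNorm_mono_ae ?_).trans (hδε i s hs hPs)⟩
  filter_upwards [hfg i] with ω hω
  simpa only [norm_indicator_eq_indicator_norm] using Set.indicator_le_indicator hω

variable [NormedSpace ℝ E] [CompleteSpace E] [IsFiniteMeasure P] {Z : Ω → E}

theorem uniformIntegrable_condExp_of_integrable (hZ : Integrable Z P)
    {𝓖 : ι → MeasurableSpace Ω} (h𝓖 : ∀ i, 𝓖 i ≤ m) :
    UniformIntegrable (fun i => P[Z | 𝓖 i]) 1 P :=
  uniformIntegrable_of_ae_norm_le (fun _ => integrable_condExp.aestronglyMeasurable)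
    (hZ.norm.uniformIntegrable_condExp h𝓖) fun i =>
      (norm_condExp_le (m := 𝓖 i) (μ := P) Z).mono fun _ h => h.trans (le_abs_self _)

theorem ae_eq_condExp_of_tendsto_condExp (hZ : Integrable Z P) {𝓗 : MeasurableSpace Ω}
    {𝓖 : ℕ → MeasurableSpace Ω} (h𝓖 : ∀ n, 𝓖 n ≤ m) (h𝓗 : ∀ n, 𝓗 ≤ 𝓖 n) {R : Ω → E}
    (hR : StronglyMeasurable[𝓗] R)
    (hlim : ∀ᵐ ω ∂P, Tendsto (fun n => (P[Z | 𝓖 n]) ω) atTop (𝓝 (R ω))) :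
    R =ᵐ[P] P[Z | 𝓗] := by
  have hUI := uniformIntegrable_condExp_of_integrable hZ h𝓖
  have hRint : Integrable R P := hUI.integrable_of_ae_tendsto hlim
  have tendsto_L1 : Tendsto (fun n => eLpNorm (P[Z | 𝓖 n] - R) 1 P) atTop (𝓝 0) :=
    tendsto_Lp_finite_of_tendsto_ae le_rfl ENNReal.one_ne_top hUI.1
      (memLp_one_iff_integrable.2 hRint) hUI.2.1 hlim
  have contraction : ∀ n, eLpNorm (R - P[Z | 𝓗]) 1 P ≤ eLpNorm (P[Z | 𝓖 n] - R) 1 P := by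
    intro n
    have h : P[P[Z | 𝓖 n] - R | 𝓗] =ᵐ[P] P[Z | 𝓗] - R := by
      refine (condExp_sub integrable_condExp hRint 𝓗).trans ?_
      rw [condExp_of_stronglyMeasurable ((h𝓗 0).trans (h𝓖 0)) hR hRint]
      exact (condExp_condExp_of_le (h𝓗 n) (h𝓖 n)).sub EventuallyEq.rfl
    rw [eLpNorm_sub_comm, ← eLpNorm_congr_ae h]
    exact eLpNorm_condExp_le_eLpNorm _ le_rfl
  rw [← sub_ae_eq_zero, ← eLpNorm_eq_zero_iff (hRint.sub integrable_condExp).aestronglyMeasurable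
    one_ne_zero]
  exact le_antisymm (ge_of_tendsto' tendsto_L1 contraction) bot_le

end UniformIntegrability

section CadlagModification

variable {Ω J E : Type*} {m : MeasurableSpace Ω} [LinearOrder J] [TopologicalSpace J]

theorem exists_seq_tendsto_nhdsWithin_Ioi_inter [OrderTopology J] [FirstCountableTopology J]
    {D : Set J} (hD : Dense D) {t u : J} [(𝓝[>] t).NeBot] (htu : t < u) :
    ∃ σ : ℕ → J, Tendsto σ atTop (𝓝[Set.Ioi t ∩ D] t) ∧ ∀ n, σ n ∈ Set.Ioo t u := by
  have := neBot_nhdsWithin_Ioi_inter hD (t := t)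
  refine exists_seq_forall_of_frequently (Eventually.frequently ?_)
  filter_upwards [self_mem_nhdsWithin, mem_nhdsWithin_of_mem_nhds (Iio_mem_nhds htu)]
    with s hts hsu
  exact ⟨hts.1, hsu⟩

theorem stronglyMeasurable_of_forall_gt [OrderTopology J] {𝓕 : Filtration J m}
    [𝓕.IsRightContinuous] [TopologicalSpace E] [TopologicalSpace.PseudoMetrizableSpace E] {t : J}
    [h : (𝓝[>] t).NeBot] {Z : Ω → E} (hZ : ∀ u, t < u → StronglyMeasurable[𝓕 u] Z) :
    StronglyMeasurable[𝓕 t] Z := by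
  borelize E
  obtain ⟨u, hu⟩ := h.nonempty_of_mem self_mem_nhdsWithin
  refine stronglyMeasurable_iff_measurable_separable.2 ⟨fun B hB => ?_, (hZ u hu).isSeparable_range⟩
  refine Filtration.IsRightContinuous.measurableSet (𝓕 := 𝓕) (i := t) ?_
  rw [𝓕.rightCont_eq_of_neBot_nhdsGT]
  simp only [MeasurableSpace.measurableSet_iInf]
  exact fun v hv => (hZ v hv).measurable hB

variable [NormedAddCommGroup E]

/-- The process of right limits along `D` of the process `Y`, set to `0` on the event that the path
of `Y` has infinitely many oscillations of some size along `D`, so that all its paths are càdlàg. -/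
noncomputable def cadlagModification (D : Set J) (Y : J → Ω → E) (t : J) : Ω → E :=
  {ω | HasFiniteOscillationsOn (Y · ω) D}.indicator fun ω => rightLimAlong D (Y · ω) t

variable {D : Set J} {Y : J → Ω → E}

theorem cadlagModification_apply {ω : Ω} (hω : HasFiniteOscillationsOn (Y · ω) D) (t : J) :
    cadlagModification D Y t ω = rightLimAlong D (Y · ω) t :=
  Set.indicator_of_mem hω _

theorem cadlagModification_apply_of_not {ω : Ω} (hω : ¬ HasFiniteOscillationsOn (Y · ω) D)
    (t : J) : cadlagModification D Y t ω = 0 :=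
  Set.indicator_of_notMem hω _

theorem cadlagModification_of_nhdsGT_eq_bot {t : J} (ht : 𝓝[>] t = ⊥) :
    cadlagModification D Y t = {ω | HasFiniteOscillationsOn (Y · ω) D}.indicator (Y t) := by
  unfold cadlagModification
  congr 1
  exact funext fun ω => if_pos ht

variable [CompleteSpace E] [OrderTopology J]

theorem isCadlagPath_cadlagModification (hD : Dense D) (hD' : ∀ t, 𝓝[>] t = ⊥ → t ∈ D) (ω : Ω) :
    IsCadlagPath (cadlagModification D Y · ω) := by
  by_cases hω : HasFiniteOscillationsOn (Y · ω) D
  · simp only [cadlagModification_apply hω]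
    exact hω.isCadlagPath_rightLimAlong hD hD'
  · simp only [cadlagModification_apply_of_not hω]
    exact fun t => ⟨continuousWithinAt_const, 0, tendsto_const_nhds⟩

theorem tendsto_cadlagModification (hD : Dense D) (t : J) [(𝓝[>] t).NeBot] (ω : Ω) :
    Tendsto (fun s => {ω | HasFiniteOscillationsOn (Y · ω) D}.indicator (Y s) ω)
      (𝓝[Set.Ioi t ∩ D] t) (𝓝 (cadlagModification D Y t ω)) := by
  by_cases hω : HasFiniteOscillationsOn (Y · ω) D
  · rw [cadlagModification_apply hω]
    exact (hω.tendsto_rightLimAlong hD).congr fun s => (Set.indicator_of_mem hω (Y s)).symm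
  · rw [cadlagModification_apply_of_not hω]
    exact tendsto_const_nhds.congr fun s => (Set.indicator_of_notMem hω (Y s)).symm

variable [FirstCountableTopology J] {𝓕 : Filtration J m} [𝓕.IsRightContinuous]

theorem stronglyAdapted_cadlagModification (hD : Dense D) (hY : StronglyAdapted 𝓕 Y)
    (hgood : ∀ t, MeasurableSet[𝓕 t] {ω | HasFiniteOscillationsOn (Y · ω) D}) :
    StronglyAdapted 𝓕 (cadlagModification D Y) := by
  intro t
  rcases (𝓝[>] t).eq_or_neBot with ht | ht
  · rw [cadlagModification_of_nhdsGT_eq_bot ht]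
    exact (hY t).indicator (hgood t)
  refine stronglyMeasurable_of_forall_gt fun u htu => ?_
  obtain ⟨σ, hσ, hσu⟩ := exists_seq_tendsto_nhdsWithin_Ioi_inter hD htu
  refine stronglyMeasurable_of_tendsto atTop
    (fun n => ((hY (σ n)).mono (𝓕.mono (hσu n).2.le)).indicator (hgood u)) ?_
  exact tendsto_pi_nhds.2 fun ω => (tendsto_cadlagModification hD t ω).comp hσ

variable [NormedSpace ℝ E] {P : Measure Ω} [IsFiniteMeasure P]

theorem cadlagModification_ae_eq (hD : Dense D) (hY : Martingale Y 𝓕 P)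
    (hgood : ∀ t, MeasurableSet[𝓕 t] {ω | HasFiniteOscillationsOn (Y · ω) D})
    (hgood' : ∀ᵐ ω ∂P, HasFiniteOscillationsOn (Y · ω) D) (t : J) :
    cadlagModification D Y t =ᵐ[P] Y t := by
  rcases (𝓝[>] t).eq_or_neBot with ht | ht
  · rw [cadlagModification_of_nhdsGT_eq_bot ht]
    exact indicator_ae_eq_of_ae_eq_set (eventuallyEq_univ.2 hgood') |>.trans (by simp)
  obtain ⟨u, htu⟩ := ht.nonempty_of_mem self_mem_nhdsWithin
  obtain ⟨σ, hσ, hσu⟩ := exists_seq_tendsto_nhdsWithin_Ioi_inter hD htu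
  have closed_by_Yu : ∀ᵐ ω ∂P, ∀ n, (P[Y u | 𝓕 (σ n)]) ω = Y (σ n) ω :=
    ae_all_iff.2 fun n => hY.condExp_ae_eq (hσu n).2.le
  refine (ae_eq_condExp_of_tendsto_condExp (hY.integrable u) (fun n => 𝓕.le (σ n))
    (fun n => 𝓕.mono (hσu n).1.le) (stronglyAdapted_cadlagModification hD hY.1 hgood t) ?_).trans
    (hY.condExp_ae_eq htu.le)
  filter_upwards [hgood', closed_by_Yu] with ω hω hYu
  rw [cadlagModification_apply hω]
  exact ((hω.tendsto_rightLimAlong hD).comp hσ).congr fun n => (hYu n).symm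

end CadlagModification

namespace IsSquareIntegrableMartingale

variable {Ω J E : Type*} {m : MeasurableSpace Ω} {P : Measure Ω} [IsFiniteMeasure P]
  [NormedAddCommGroup E] [InnerProductSpace ℝ E] [CompleteSpace E]

theorem exists_isCadlagPath_modification [LinearOrder J] [TopologicalSpace J] [OrderTopology J]
    [SecondCountableTopology J] {𝓕 : Filtration J m} [𝓕.IsRightContinuous]
    (hnull : ∀ t s, P s = 0 → MeasurableSet[𝓕 t] s) {Y : J → Ω → E}
    (hY : IsSquareIntegrableMartingale Y 𝓕 P) {C : ℝ} (hC : ∀ t, ∫ ω, ‖Y t ω‖ ^ 2 ∂P ≤ C) :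
    ∃ X : J → Ω → E, (∀ ω, IsCadlagPath (X · ω)) ∧ (∀ t, X t =ᵐ[P] Y t) ∧
      IsSquareIntegrableMartingale X 𝓕 P := by
  obtain ⟨D, hDc, hD, hD'⟩ := exists_countable_dense_of_nhdsGT_eq_bot J
  have hgood := hY.ae_hasFiniteOscillationsOn hC hDc
  have hgood_meas : ∀ t, MeasurableSet[𝓕 t] {ω | HasFiniteOscillationsOn (Y · ω) D} :=
    fun t => .of_compl (hnull t _ (mem_ae_iff.1 hgood))
  have hXY := cadlagModification_ae_eq hD hY.1 hgood_meas hgood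
  exact ⟨cadlagModification D Y, isCadlagPath_cadlagModification hD hD', hXY,
    hY.1.congr (stronglyAdapted_cadlagModification hD hY.1.1 hgood_meas) fun t => (hXY t).symm,
    fun t => (hY.2 t).ae_eq (hXY t).symm⟩

end IsSquareIntegrableMartingale

section Radonification

theorem hasSum_sq_inner_hilbertBasis {ι E : Type*} [NormedAddCommGroup E] [InnerProductSpace ℝ E]
    (b : HilbertBasis ι ℝ E) (x : E) : HasSum (fun i => inner ℝ x (b i) ^ 2) (‖x‖ ^ 2) := by
  simpa only [real_inner_self_eq_norm_sq, real_inner_comm x, ← sq] using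
    b.hasSum_inner_mul_inner x x

theorem IsHilbertSchmidt.summable_norm_adjoint_sq {H : Type u} {G κ : Type*}
    [NormedAddCommGroup H] [InnerProductSpace ℝ H] [CompleteSpace H] [NormedAddCommGroup G]
    [InnerProductSpace ℝ G] [CompleteSpace G] {S : H →L[ℝ] G} (hS : IsHilbertSchmidt S)
    (b : HilbertBasis κ ℝ G) : Summable fun k => ‖ContinuousLinearMap.adjoint S (b k)‖ ^ 2 := by
  obtain ⟨ι, e, he⟩ := hS
  have rows : ∀ i, HasSum (fun k => inner ℝ (S (e i)) (b k) ^ 2) (‖S (e i)‖ ^ 2) :=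
    fun i => hasSum_sq_inner_hilbertBasis b (S (e i))
  have columns : ∀ k, HasSum (fun i => inner ℝ (S (e i)) (b k) ^ 2)
      (‖ContinuousLinearMap.adjoint S (b k)‖ ^ 2) := fun k => by
    simpa only [ContinuousLinearMap.adjoint_inner_left, real_inner_comm (b k)] using
      hasSum_sq_inner_hilbertBasis e (ContinuousLinearMap.adjoint S (b k))
  have entries : Summable fun p : ι × κ => inner ℝ (S (e p.1)) (b p.2) ^ 2 :=
    (summable_prod_of_nonneg fun p => sq_nonneg _).2
      ⟨fun i => (rows i).summable, by simpa only [(rows _).tsum_eq] using he⟩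
  have entries_swap : Summable fun p : κ × ι => inner ℝ (S (e p.2)) (b p.1) ^ 2 :=
    (Equiv.prodComm κ ι).summable_iff.2 entries
  simpa only [(columns _).tsum_eq] using
    ((summable_prod_of_nonneg fun p => sq_nonneg _).1 entries_swap).2

variable {Ω G : Type*} {m : MeasurableSpace Ω} {P : Measure Ω}
  [NormedAddCommGroup G] [InnerProductSpace ℝ G]

/-- The isometry from real to `G`-valued square integrable random variables given by multiplication
with a fixed unit vector. For orthogonal unit vectors the ranges are orthogonal. -/
noncomputable def lpSMulUnit (P : Measure Ω) (g : G) (hg : ‖g‖ = 1) :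
    Lp ℝ 2 P →ₗᵢ[ℝ] Lp G 2 P :=
  LinearMap.isometryOfInner ((ContinuousLinearMap.toSpanSingleton ℝ g).compLpₗ 2 P) fun x y => by
    rw [L2.inner_def, L2.inner_def]
    refine integral_congr_ae ?_
    filter_upwards [(ContinuousLinearMap.toSpanSingleton ℝ g).coeFn_compLp x,
      (ContinuousLinearMap.toSpanSingleton ℝ g).coeFn_compLp y] with ω hx hy
    simp only [ContinuousLinearMap.compLpₗ_apply, hx, hy]
    simp [inner_smul_left, inner_smul_right, hg, mul_comm]

theorem coeFn_lpSMulUnit {g : G} (hg : ‖g‖ = 1) (x : Lp ℝ 2 P) :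
    ∀ᵐ ω ∂P, lpSMulUnit P g hg x ω = x ω • g :=
  (ContinuousLinearMap.toSpanSingleton ℝ g).coeFn_compLp x

theorem orthogonalFamily_lpSMulUnit {κ : Type*} {b : κ → G} (hb : Orthonormal ℝ b) :
    OrthogonalFamily ℝ (fun _ : κ => Lp ℝ 2 P) fun k => lpSMulUnit P (b k) (hb.1 k) := by
  intro i j hij x y
  rw [L2.inner_def]
  refine integral_eq_zero_of_ae ?_
  filter_upwards [coeFn_lpSMulUnit (hb.1 i) x, coeFn_lpSMulUnit (hb.1 j) y] with ω hx hy
  rw [hx, hy, inner_smul_left, inner_smul_right, hb.2 hij, mul_zero, mul_zero, Pi.zero_apply]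

theorem innerSL_compLpL_lpSMulUnit (g : G) {e : G} (he : ‖e‖ = 1) (x : Lp ℝ 2 P) :
    (innerSL ℝ g).compLpL 2 P (lpSMulUnit P e he x) = inner ℝ g e • x := by
  refine Lp.ext ?_
  filter_upwards [(innerSL ℝ g).coeFn_compLpL (lpSMulUnit P e he x), coeFn_lpSMulUnit he x,
    Lp.coeFn_smul (inner ℝ g e) x] with ω h1 h2 h3
  rw [h1, h2, h3, innerSL_apply_apply, inner_smul_right, Pi.smul_apply, smul_eq_mul, mul_comm]

theorem exists_lp_inner_ae_eq_of_summable_norm_sq [CompleteSpace G] {κ : Type*}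
    (b : HilbertBasis κ ℝ G) (A : G →L[ℝ] Lp ℝ 2 P) (hA : Summable fun k => ‖A (b k)‖ ^ 2) :
    ∃ Z : Lp G 2 P, ∀ g, ∀ᵐ ω ∂P, inner ℝ (Z ω) g = A g ω := by
  obtain ⟨Z, hZ⟩ := ((orthogonalFamily_lpSMulUnit b.orthonormal).summable_iff_norm_sq_summable
    fun k => A (b k)).2 hA
  refine ⟨Z, fun g => ?_⟩
  have hZg := ((innerSL ℝ g).compLpL 2 P).hasSum hZ
  have hAg := A.hasSum (b.hasSum_repr g)
  simp only [innerSL_compLpL_lpSMulUnit] at hZg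
  simp only [map_smul, b.repr_apply_apply, real_inner_comm g] at hAg
  filter_upwards [(innerSL ℝ g).coeFn_compLpL (p := 2) Z] with ω hω
  rw [← hZg.unique hAg, hω, innerSL_apply_apply, real_inner_comm]

theorem CylindricalRV.exists_linearMap_lp {H : Type*} [NormedAddCommGroup H]
    [InnerProductSpace ℝ H] {Y : CylindricalRV H P} (hY : ∀ h, MemLp (Y h) 2 P) :
    ∃ B : H →ₗ[ℝ] Lp ℝ 2 P, ∀ h, B h =ᵐ[P] Y h := by
  refine ⟨IsLinearMap.mk' (fun h => (hY h).toLp (Y h)) ⟨fun x y => ?_, fun c x => ?_⟩,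
    fun h => (hY h).coeFn_toLp⟩
  · rw [← MemLp.toLp_add]
    exact MemLp.toLp_congr _ _ (by rw [map_add]; exact AEEqFun.coeFn_add _ _)
  · rw [← MemLp.toLp_const_smul]
    exact MemLp.toLp_congr _ _ (by rw [map_smul]; exact AEEqFun.coeFn_smul _ _)

theorem CylindricalRV.IsContinuous.exists_clm_lp {H : Type*} [NormedAddCommGroup H]
    [InnerProductSpace ℝ H] [CompleteSpace H] {Y : CylindricalRV H P} (hY : Y.IsContinuous)
    (hY2 : ∀ h, MemLp (Y h) 2 P) : ∃ B : H →L[ℝ] Lp ℝ 2 P, ∀ h, B h =ᵐ[P] Y h := by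
  obtain ⟨B, hB⟩ := CylindricalRV.exists_linearMap_lp hY2
  refine ⟨⟨B, B.continuous_of_seq_closed_graph fun x h y hx hxy => Lp.ext ?_⟩, hB⟩
  have limit_lp : TendstoInMeasure P (fun n ω => Y (x n) ω) atTop y :=
    (tendstoInMeasure_of_tendsto_Lp hxy).congr_left fun n => hB (x n)
  have limit_L0 : TendstoInMeasure P (fun n ω => Y (x n) ω) atTop (Y h) := (hY h).comp hx
  exact (tendstoInMeasure_ae_unique limit_lp limit_L0).trans (hB h).symm

theorem IsHilbertSchmidt.exists_memLp_inner_ae_eq [CompleteSpace G] {H : Type*}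
    [NormedAddCommGroup H] [InnerProductSpace ℝ H] [CompleteSpace H] {S : H →L[ℝ] G}
    (hS : IsHilbertSchmidt S) {Y : CylindricalRV H P} (hY : Y.IsContinuous)
    (hY2 : ∀ h, MemLp (Y h) 2 P) :
    ∃ Z : Ω → G, MemLp Z 2 P ∧
      ∀ g, (fun ω => inner ℝ (Z ω) g) =ᵐ[P] Y (ContinuousLinearMap.adjoint S g) := by
  obtain ⟨B, hB⟩ := hY.exists_clm_lp hY2
  obtain ⟨w, b, -⟩ := exists_hilbertBasis ℝ G
  have hBS : Summable fun k => ‖(B ∘L ContinuousLinearMap.adjoint S) (b k)‖ ^ 2 := by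
    refine ((hS.summable_norm_adjoint_sq b).mul_left (‖B‖ ^ 2)).of_nonneg_of_le
      (fun k => sq_nonneg _) fun k => ?_
    rw [← mul_pow]
    gcongr
    exact B.le_opNorm _
  obtain ⟨Z, hZ⟩ := exists_lp_inner_ae_eq_of_summable_norm_sq b _ hBS
  exact ⟨Z, Lp.memLp Z, fun g => EventuallyEq.trans (hZ g) (hB _)⟩

end Radonification

theorem inner_condExp_ae_eq {Ω E : Type*} {𝓖 m : MeasurableSpace Ω} {P : Measure Ω}
    [NormedAddCommGroup E] [InnerProductSpace ℝ E] [CompleteSpace E] {Z : Ω → E}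
    (hZ : Integrable Z P) (g : E) :
    (fun ω => inner ℝ ((P[Z | 𝓖]) ω) g) =ᵐ[P] P[fun ω => inner ℝ (Z ω) g | 𝓖] := by
  simpa only [Function.comp_def, innerSL_apply_apply, real_inner_comm] using
    (innerSL ℝ g).comp_condExp_comm (m := 𝓖) hZ

theorem isSquareIntegrableMartingale_condExp {Ω J E : Type*} {m : MeasurableSpace Ω}
    {P : Measure Ω} [IsFiniteMeasure P] [NormedAddCommGroup E] [NormedSpace ℝ E] [CompleteSpace E]
    [Preorder J] (𝓕 : Filtration J m) {Z : Ω → E} (hZ : MemLp Z 2 P) :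
    IsSquareIntegrableMartingale (fun t => P[Z | 𝓕 t]) 𝓕 P :=
  ⟨martingale_condExp Z 𝓕 P, fun _ => hZ.condExp one_le_two⟩

theorem UsualConditions.isRightContinuous_restrictIcc {Ω : Type*} {m : MeasurableSpace Ω}
    {P : Measure Ω} {𝓕 : Filtration ℝ≥0 m} (h𝓕 : UsualConditions 𝓕 P) (T : ℝ≥0) :
    (𝓕.restrictIcc T).IsRightContinuous where
  RC t := by
    rcases (𝓝[>] t).eq_or_neBot with ht | ht
    · rw [Filtration.rightCont_eq_of_nhdsGT_eq_bot _ ht]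
    have := h𝓕.rightContinuous
    refine le_trans ?_ (Filtration.IsRightContinuous.RC (𝓕 := 𝓕) (t : ℝ≥0))
    rw [Filtration.rightCont_eq_of_neBot_nhdsGT, Filtration.rightCont_eq]
    obtain ⟨v, hv⟩ := ht.nonempty_of_mem self_mem_nhdsWithin
    refine le_iInf₂ fun u hu => ?_
    have htu : t < (⟨min u T, zero_le, min_le_right _ _⟩ : Set.Icc (0 : ℝ≥0) T) :=
      lt_min hu (lt_of_lt_of_le hv v.2.2)
    exact (iInf₂_le _ htu).trans (𝓕.mono (min_le_left u T))

theorem UsualConditions.measurableSet_restrictIcc_of_null {Ω : Type*} {m : MeasurableSpace Ω}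
    {P : Measure Ω} {𝓕 : Filtration ℝ≥0 m} (h𝓕 : UsualConditions 𝓕 P) {T : ℝ≥0}
    (t : Set.Icc (0 : ℝ≥0) T) (s : Set Ω) (hs : P s = 0) : MeasurableSet[𝓕.restrictIcc T t] s :=
  𝓕.mono zero_le _ (h𝓕.null_measurable s hs)

theorem mainTheorem2_general {Ω J H G : Type*} {m : MeasurableSpace Ω} {P : Measure Ω}
    [IsFiniteMeasure P] [LinearOrder J] [TopologicalSpace J] [OrderTopology J]
    [SecondCountableTopology J] {𝓕 : Filtration J m} [𝓕.IsRightContinuous]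
    (hnull : ∀ t s, P s = 0 → MeasurableSet[𝓕 t] s)
    [NormedAddCommGroup H] [InnerProductSpace ℝ H] [CompleteSpace H]
    [NormedAddCommGroup G] [InnerProductSpace ℝ G] [CompleteSpace G]
    {M : J → CylindricalRV H P} (hM : IsCylindricalSquareIntegrableMartingale M 𝓕)
    {τ : J} (hτ : IsTop τ) (hMτ : (M τ).IsContinuous) {S : H →L[ℝ] G} (hS : IsHilbertSchmidt S) :
    IsCylindricalSquareIntegrableMartingale (cylindricalCompAdjoint M S) 𝓕 ∧
    ∃ X : J → Ω → G, IsVersionOf X (cylindricalCompAdjoint M S) ∧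
      (∀ ω, IsCadlagPath fun t => X t ω) ∧ IsSquareIntegrableMartingale X 𝓕 P := by
  have hMS : IsCylindricalSquareIntegrableMartingale (cylindricalCompAdjoint M S) 𝓕 :=
    fun g => hM (ContinuousLinearMap.adjoint S g)
  obtain ⟨Z, hZ2, hZ⟩ := hS.exists_memLp_inner_ae_eq hMτ fun h => (hM h).2 τ
  have hY := isSquareIntegrableMartingale_condExp 𝓕 hZ2
  obtain ⟨X, hXcad, hXY, hX⟩ := hY.exists_isCadlagPath_modification hnull
    fun t => hY.monotone_integral_norm_sq (hτ t)
  refine ⟨hMS, X, fun t g => ?_, hXcad, hX⟩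
  filter_upwards [hXY t, inner_condExp_ae_eq (𝓖 := 𝓕 t) (hZ2.integrable one_le_two) g,
    condExp_congr_ae (m := 𝓕 t) (hZ g), (hMS g).1.condExp_ae_eq (hτ t)] with ω hXt hinner hcond hMt
  rw [hXt, hinner, hcond]
  exact hMt

theorem mainTheorem2 {Ω : Type*} {m : MeasurableSpace Ω} (P : Measure Ω) [IsProbabilityMeasure P]
    [P.IsComplete] (𝓕 : Filtration ℝ≥0 m) (h𝓕 : UsualConditions 𝓕 P)
    {H : Type*} [NormedAddCommGroup H] [InnerProductSpace ℝ H] [CompleteSpace H]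
    [TopologicalSpace.SeparableSpace H]
    {G : Type*} [NormedAddCommGroup G] [InnerProductSpace ℝ G] [CompleteSpace G]
    [TopologicalSpace.SeparableSpace G]
    (T : ℝ≥0) (hT : 0 < T)
    (M : Set.Icc (0 : ℝ≥0) T → CylindricalRV H P)
    (hM : IsCylindricalSquareIntegrableMartingale M (𝓕.restrictIcc T))
    (hMcont : ∀ t, (M t).IsContinuous)
    (S : H →L[ℝ] G) (hS : IsHilbertSchmidt S) :
    IsCylindricalSquareIntegrableMartingale (cylindricalCompAdjoint M S) (𝓕.restrictIcc T) ∧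
    ∃ X : Set.Icc (0 : ℝ≥0) T → Ω → G,
      IsVersionOf X (cylindricalCompAdjoint M S) ∧
      (∀ ω, IsCadlagPath fun t => X t ω) ∧
      IsSquareIntegrableMartingale X (𝓕.restrictIcc T) P := by
  have := h𝓕.isRightContinuous_restrictIcc T
  exact mainTheorem2_general (τ := (⟨T, hT.le, le_rfl⟩ : Set.Icc (0 : ℝ≥0) T))
    h𝓕.measurableSet_restrictIcc_of_null hM (fun t => t.2.2) (hMcont _) hS
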